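/- For $(c,a)\in\mathbb{C}^2$ let $P_{c,a}(z)=\frac13 z^3-\frac{c}{2}z^2+a^3$, whose critical points are $c_0:=c$ and $c_1:=0$. A parameter $(c,a)$ is called post-critically finite if every critical point of $P_{c,a}$ has a finite forward orbit under iteration of $P_{c,a}$. Let $n\ge 0$ and $k>0$ be integers and let $i\in\{0,1\}$. Then any irreducible component $C$ (for the Zariski topology of $\mathbb{C}^2$) of the algebraic set $$\{(c,a)\in\mathbb{C}^2 : P_{c,a}^{n+k}(c_i)=P_{c,a}^{n}(c_i)\}$$ contains infinitely many post-critically finite parameters $(c,a)$. -/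

import Mathlib

/-- The space `Poly₃ ≃ 𝔸²` of complex parameters `x = (c, a)`, with `c = x 0` and `a = x 1`. -/
abbrev Poly3 : Type := Fin 2 → ℂ

namespace Poly3

/-- The cubic polynomial map `P_{c,a}(z) = z³/3 - (c/2) z² + a³`. -/
noncomputable def P (x : Poly3) (z : ℂ) : ℂ :=
  (1 / 3) * z ^ 3 - (x 0 / 2) * z ^ 2 + x 1 ^ 3

/-- The two marked critical points `c₀ = c` and `c₁ = 0` of `P_{c,a}`. -/
def crit (x : Poly3) : Fin 2 → ℂ := ![x 0, 0]

/-- `P_{c,a}` is post-critically finite: every critical point has a finite forward orbit. -/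
def IsPCF (x : Poly3) : Prop :=
  ∀ z : ℂ, deriv (P x) z = 0 → (Set.range fun m : ℕ => (P x)^[m] z).Finite

/-- The set of parameters with `P^{n+k}(c_i) = P^n(c_i)`. -/
def preperLocus (n k : ℕ) (i : Fin 2) : Set Poly3 :=
  {x | (P x)^[n + k] (crit x i) = (P x)^[n] (crit x i)}

/-- The Zariski topology on `ℂ²`: the closed sets are the zero loci of families of polynomials. -/
abbrev zariski : TopologicalSpace Poly3 :=
  TopologicalSpace.ofClosed
    {Z | ∃ S : Set (MvPolynomial (Fin 2) ℂ), Z = {x | ∀ f ∈ S, MvPolynomial.eval x f = 0}}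
    ⟨{1}, by ext x; simp⟩
    (by
      intro A hA
      refine ⟨{f | ∃ Z ∈ A, ∀ x ∈ Z, MvPolynomial.eval x f = 0}, ?_⟩
      ext x
      constructor
      · rintro hx f ⟨Z, hZ, hf⟩
        exact hf x (hx Z hZ)
      · intro hx Z hZ
        obtain ⟨S, rfl⟩ := hA hZ
        exact fun f hf => hx f ⟨_, hZ, fun y hy => hy f hf⟩)
    (by
      rintro _ ⟨S, rfl⟩ _ ⟨T, rfl⟩
      refine ⟨{h | ∃ f ∈ S, ∃ g ∈ T, h = f * g}, ?_⟩
      ext x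
      constructor
      · rintro (hx | hx) _ ⟨f, hf, g, hg, rfl⟩
        · simp [hx f hf]
        · simp [hx g hg]
      · intro hx
        by_contra hcon
        simp only [Set.mem_union, Set.mem_ofPred_eq, not_or, not_forall] at hcon
        obtain ⟨⟨f, hf, hfx⟩, g, hg, hgx⟩ := hcon
        have h := hx _ ⟨f, hf, g, hg, rfl⟩
        rw [map_mul] at h
        exact (mul_ne_zero hfx hgx) h)

/-- `C` is an irreducible component of `Z ⊆ ℂ²`: a maximal Zariski-irreducible subset of `Z`. -/
def IsIrredComponent (C Z : Set Poly3) : Prop :=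
  Maximal (fun D : Set Poly3 => D ⊆ Z ∧ @IsIrreducible Poly3 zariski D) C

end Poly3

/-! Let `c_j` be the other critical point. On the component `C` the orbit of `c_i` is finite, so
near infinity `P(c_i)` is small; this forces `P(c_j)` to be large, and `c_j` escapes. Hence the
polynomial `q_m = (P^m(c_j) - c_j) / (P(c_j) - c_j)`, `m ≥ 2`, grows at least linearly along `C`
(`norm_iterate_crit_sub_ge`). As `C` is the zero set of a polynomial monic in `a`, it is finite over
the `c`-line; were `q_m` zero-free on `C`, its norm to `ℂ[c]` would be constant, against the growth.
So `q_m` vanishes somewhere on `C`. There `c_j` is periodic but not fixed, since `q_m = 1` whenever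
`c_j` is fixed. For prime `m` the exact period is `m`, so distinct primes give distinct
post-critically finite parameters. -/

/-! ### Resultants and growth along a plane curve -/

open Polynomial in
/-- A bivariate polynomial, monic in `Y`, cuts out a curve which is finite over the `X`-axis. Hence
a polynomial `h` without zeros on the curve cannot grow at least linearly in `X` along it. -/
theorem Polynomial.Monic.exists_evalEval_eq_zero_of_norm_le {f h : ℂ[X][X]} (hf : f.Monic)
    (hdeg : f.natDegree ≠ 0) (M : ℝ)
    (hgrow : ∀ x y : ℂ, f.evalEval x y = 0 → M ≤ ‖x‖ → ‖x‖ ≤ ‖h.evalEval x y‖) :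
    ∃ x y : ℂ, f.evalEval x y = 0 ∧ h.evalEval x y = 0 := by
  by_contra! hne
  set N : ℂ[X] := resultant f h with hN
  have key : ∀ x : ℂ, N.eval x =
      ((f.map (evalRingHom x)).roots.map fun y => h.evalEval x y).prod := by
    intro x
    have h1 := resultant_map_map f h f.natDegree h.natDegree (evalRingHom x)
    rw [← hN, coe_evalRingHom] at h1
    rw [← h1]
    -- `h` may drop degree at `x`; this is harmless because `f` stays monic.
    have h2 := resultant_eq_prod_eval (f.map (evalRingHom x)) (h.map (evalRingHom x)) h.natDegree
      natDegree_map_le (IsAlgClosed.splits _)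
    rw [hf.natDegree_map, (hf.map _).leadingCoeff, one_pow, one_mul] at h2
    rw [h2]
    congr 1
    exact Multiset.map_congr rfl fun y _ => map_evalRingHom_eval x y h
  have hroot : ∀ x : ℂ, ∀ y ∈ (f.map (evalRingHom x)).roots, f.evalEval x y = 0 := by
    intro x y hy
    rw [← map_evalRingHom_eval]
    exact (mem_roots'.1 hy).2
  have hN0 : ∀ x : ℂ, N.eval x ≠ 0 := by
    intro x hx
    rw [key, Multiset.prod_eq_zero_iff, Multiset.mem_map] at hx
    obtain ⟨y, hy, hy0⟩ := hx
    exact hne x y (hroot x y hy) hy0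
  have hNdeg : N.degree = 0 := by
    by_contra hd
    obtain ⟨x, hx⟩ := IsAlgClosed.exists_root N hd
    exact hN0 x hx
  have hNC := eq_C_of_degree_eq_zero hNdeg
  -- `K` exceeds the norm of the constant `N`, yet at `x = K` every factor of the product has norm
  -- at least `K`.
  set K : ℝ := max M 1 + ‖N.coeff 0‖ with hK
  have hK1 : 1 ≤ K := le_add_of_le_of_nonneg (le_max_right _ _) (norm_nonneg _)
  have hKM : M ≤ K := le_add_of_le_of_nonneg (le_max_left _ _) (norm_nonneg _)
  have hnK : ‖(K : ℂ)‖ = K := by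
    rw [Complex.norm_real, Real.norm_of_nonneg (by linarith)]
  have hprod : ∀ s : Multiset ℂ, (∀ y ∈ s, K ≤ ‖h.evalEval (K : ℂ) y‖) →
      K ^ s.card ≤ ‖(s.map fun y => h.evalEval (K : ℂ) y).prod‖ := by
    intro s
    induction s using Multiset.induction_on with
    | empty => simp
    | cons a s ih =>
      intro hs
      rw [Multiset.map_cons, Multiset.prod_cons, norm_mul, Multiset.card_cons, pow_succ']
      exact mul_le_mul (hs a (Multiset.mem_cons_self a s))
        (ih fun y hy => hs y (Multiset.mem_cons_of_mem hy)) (by positivity) (norm_nonneg _)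
  have h3 := hprod (f.map (evalRingHom (K : ℂ))).roots fun y hy => by
    have := hgrow K y (hroot K y hy) (by rwa [hnK])
    rwa [hnK] at this
  rw [← key, hNC, eval_C, splits_iff_card_roots.1 (IsAlgClosed.splits _), hf.natDegree_map] at h3
  have h4 : K ≤ K ^ f.natDegree := le_self_pow₀ hK1 hdeg
  have h5 : (1 : ℝ) ≤ max M 1 := le_max_right _ _
  linarith

/-! ### Zariski-irreducible components of plane curves -/

namespace Poly3

theorem isClosed_zariski_iff {Z : Set Poly3} :
    @IsClosed _ zariski Z ↔
      ∃ S : Set (MvPolynomial (Fin 2) ℂ), Z = {x | ∀ f ∈ S, MvPolynomial.eval x f = 0} := by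
  rw [← @isOpen_compl_iff _ _ zariski]
  change Zᶜᶜ ∈ _ ↔ _
  rw [compl_compl]
  rfl

theorem isClosed_zariski_zeros (f : MvPolynomial (Fin 2) ℂ) :
    @IsClosed _ zariski {x : Poly3 | MvPolynomial.eval x f = 0} :=
  isClosed_zariski_iff.2 ⟨{f}, by simp⟩

theorem isPrime_vanishingIdeal {C : Set Poly3} (hC : @IsIrreducible Poly3 zariski C) :
    (MvPolynomial.vanishingIdeal ℂ C).IsPrime := by
  obtain ⟨⟨x, hx⟩, hirr⟩ := hC
  refine ⟨fun h => ?_, fun {f g} hfg => ?_⟩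
  · have h1 : (1 : MvPolynomial (Fin 2) ℂ) ∈ MvPolynomial.vanishingIdeal ℂ C :=
      h ▸ Submodule.mem_top
    simpa using h1 x hx
  · rcases (@isPreirreducible_iff_isClosed_union_isClosed _ zariski C).1 hirr _ _
      (isClosed_zariski_zeros f) (isClosed_zariski_zeros g) fun y hy => by
        simpa [MvPolynomial.aeval_eq_eval] using hfg y hy with h | h
    · exact Or.inl fun y hy => by simpa [MvPolynomial.aeval_eq_eval] using h hy
    · exact Or.inr fun y hy => by simpa [MvPolynomial.aeval_eq_eval] using h hy

theorem zeros_eq_zeroLocus (f : MvPolynomial (Fin 2) ℂ) :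
    {x : Poly3 | MvPolynomial.eval x f = 0} = MvPolynomial.zeroLocus ℂ (Ideal.span {f}) := by
  rw [MvPolynomial.zeroLocus_span]
  simp [MvPolynomial.aeval_eq_eval]

/-- By the Nullstellensatz the vanishing ideal is `(f)`, which is prime. -/
theorem isIrreducible_zeros {f : MvPolynomial (Fin 2) ℂ} (hf : Prime f) :
    @IsIrreducible Poly3 zariski {x | MvPolynomial.eval x f = 0} := by
  have hP : (Ideal.span {f}).IsPrime := (Ideal.span_singleton_prime hf.ne_zero).2 hf
  have hV : MvPolynomial.vanishingIdeal ℂ {x : Poly3 | MvPolynomial.eval x f = 0} =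
      Ideal.span {f} := by
    rw [zeros_eq_zeroLocus, MvPolynomial.IsPrime.vanishingIdeal_zeroLocus]
  refine ⟨?_, ?_⟩
  · rw [Set.nonempty_iff_ne_empty]
    intro h
    rw [h, MvPolynomial.vanishingIdeal_empty] at hV
    exact hP.ne_top hV.symm
  · rw [@isPreirreducible_iff_isClosed_union_isClosed _ zariski]
    intro Z₁ Z₂ h₁ h₂ hsub
    obtain ⟨S, rfl⟩ := isClosed_zariski_iff.1 h₁
    obtain ⟨T, rfl⟩ := isClosed_zariski_iff.1 h₂
    by_contra! hcon
    obtain ⟨hS, hT⟩ := hcon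
    obtain ⟨x, hx, hxS⟩ := Set.not_subset.1 hS
    obtain ⟨y, hy, hyT⟩ := Set.not_subset.1 hT
    simp only [Set.mem_ofPred_eq, not_forall] at hxS hyT
    obtain ⟨g, hg, hgx⟩ := hxS
    obtain ⟨h, hh, hhy⟩ := hyT
    have hgh : g * h ∈ Ideal.span {f} := by
      rw [← hV]
      intro z hz
      rw [MvPolynomial.aeval_eq_eval, map_mul]
      rcases hsub hz with h' | h'
      · rw [h' g hg, zero_mul]
      · rw [h' h hh, mul_zero]
    rcases hP.mem_or_mem hgh with h' | h' <;> rw [← hV] at h'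
    · exact hgx (by simpa [MvPolynomial.aeval_eq_eval] using h' x hx)
    · exact hhy (by simpa [MvPolynomial.aeval_eq_eval] using h' y hy)

/-- The irreducible components of a plane curve are the zero sets of the irreducible factors. -/
theorem IsIrredComponent.exists_irreducible {C : Set Poly3} {F : MvPolynomial (Fin 2) ℂ}
    (hF : F ≠ 0) (hC : IsIrredComponent C {x | MvPolynomial.eval x F = 0}) :
    ∃ f, Irreducible f ∧ f ∣ F ∧ C = {x | MvPolynomial.eval x f = 0} := by
  obtain ⟨⟨hsub, hirr⟩, hmax⟩ := hC
  have hP := isPrime_vanishingIdeal hirr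
  obtain ⟨s, hs, u, hu⟩ := UniqueFactorizationMonoid.exists_prime_factors F hF
  have hFmem : F ∈ MvPolynomial.vanishingIdeal ℂ C := fun x hx => by
    simpa [MvPolynomial.aeval_eq_eval] using hsub hx
  have hsmem : s.prod ∈ MvPolynomial.vanishingIdeal ℂ C := by
    rw [← hu] at hFmem
    exact (hP.mem_or_mem hFmem).resolve_right fun h =>
      hP.ne_top (Ideal.eq_top_of_isUnit_mem _ h u.isUnit)
  obtain ⟨f, hfs, hf⟩ := (hP.multiset_prod_mem_iff_exists_mem s).1 hsmem
  have hdvd : f ∣ F := (Multiset.dvd_prod hfs).trans (Dvd.intro _ hu)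
  have hCf : C ⊆ {x | MvPolynomial.eval x f = 0} := fun x hx => by
    simpa [MvPolynomial.aeval_eq_eval] using hf x hx
  refine ⟨f, (hs f hfs).irreducible, hdvd, hCf.antisymm (hmax ⟨?_, isIrreducible_zeros (hs f hfs)⟩
    hCf)⟩
  rintro x hx
  obtain ⟨g, rfl⟩ := hdvd
  rw [Set.mem_ofPred_eq] at hx ⊢
  rw [map_mul, hx, zero_mul]

end Poly3
-- Escape estimates for critical orbits
namespace Poly3

/-- The cubic term dominates: `1/3 - 1/6 - 1/27 = 7/54 ≥ 1/8`. -/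
theorem norm_P_ge {x : Poly3} {M : ℝ} {z : ℂ} (h0 : ‖x 0‖ ≤ M) (h1 : ‖x 1‖ ≤ M)
    (hz : 3 * M ≤ ‖z‖) : ‖z‖ ^ 3 / 8 ≤ ‖P x z‖ := by
  have hM : 0 ≤ M := (norm_nonneg _).trans h0
  have e : (1 / 3) * z ^ 3 = P x z + ((x 0 / 2) * z ^ 2 - x 1 ^ 3) := by
    rw [P]
    ring
  have h2 : ‖z‖ ^ 3 / 3 ≤ ‖P x z‖ + (‖x 0‖ / 2 * ‖z‖ ^ 2 + ‖x 1‖ ^ 3) := by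
    calc ‖z‖ ^ 3 / 3 = ‖(1 / 3) * z ^ 3‖ := by
          simp
          ring
      _ ≤ ‖P x z‖ + ‖(x 0 / 2) * z ^ 2 - x 1 ^ 3‖ := e ▸ norm_add_le _ _
      _ ≤ ‖P x z‖ + (‖(x 0 / 2) * z ^ 2‖ + ‖x 1 ^ 3‖) := by
          gcongr
          exact norm_sub_le _ _
      _ = _ := by simp
  have h3 : ‖x 0‖ / 2 * ‖z‖ ^ 2 ≤ ‖z‖ / 3 / 2 * ‖z‖ ^ 2 := by
    gcongr
    linarith
  have h4 : ‖x 1‖ ^ 3 ≤ (‖z‖ / 3) ^ 3 := by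
    gcongr
    linarith
  have h5 : 0 ≤ ‖z‖ ^ 3 := by positivity
  nlinarith

theorem two_mul_le_cube_div {r : ℝ} (hr : 4 ≤ r) : 2 * r ≤ r ^ 3 / 8 := by
  nlinarith [mul_nonneg (by linarith : (0 : ℝ) ≤ r) (by nlinarith : (0 : ℝ) ≤ r ^ 2 - 16)]

/-- The norms strictly increase along an orbit which has left the disc of radius `3 * M`. -/
theorem norm_iterate_ge {x : Poly3} {M : ℝ} {z : ℂ} (h0 : ‖x 0‖ ≤ M) (h1 : ‖x 1‖ ≤ M)
    (hM : 2 ≤ M) (hz : 3 * M ≤ ‖z‖) (m : ℕ) : 2 ^ m * ‖z‖ ≤ ‖(P x)^[m] z‖ := by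
  induction m with
  | zero => simp
  | succ m ih =>
    have h2 : ‖z‖ ≤ 2 ^ m * ‖z‖ := le_mul_of_one_le_left (norm_nonneg _) (one_le_pow₀ one_le_two)
    rw [Function.iterate_succ_apply']
    have h3 := norm_P_ge h0 h1 (hz.trans (h2.trans ih))
    have h4 := two_mul_le_cube_div (r := ‖(P x)^[m] z‖) (by linarith)
    rw [pow_succ]
    linarith

/-- An orbit whose norm at least doubles at each step cannot enter a cycle. -/
theorem norm_iterate_lt_of_mem_preperLocus {x : Poly3} {n k : ℕ} {i : Fin 2} {M : ℝ} (hk : 0 < k)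
    (hx : x ∈ preperLocus n k i) (h0 : ‖x 0‖ ≤ M) (h1 : ‖x 1‖ ≤ M) (hM : 2 ≤ M) (m : ℕ) :
    ‖(P x)^[m] (crit x i)‖ < 3 * M := by
  by_contra! h
  have hx' : (P x)^[n + k] (crit x i) = (P x)^[n] (crit x i) := hx
  set w := (P x)^[m + n] (crit x i) with hw
  have hwM : ‖(P x)^[m] (crit x i)‖ ≤ ‖w‖ := by
    have h2 := norm_iterate_ge h0 h1 hM h n
    rw [← Function.iterate_add_apply, add_comm n m] at h2
    exact (le_mul_of_one_le_left (norm_nonneg _) (one_le_pow₀ one_le_two)).trans h2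
  have hper : (P x)^[k] w = w := by
    rw [hw, ← Function.iterate_add_apply, show k + (m + n) = m + (n + k) by omega,
      Function.iterate_add_apply, hx', ← Function.iterate_add_apply]
  have h3 := norm_iterate_ge h0 h1 hM (h.trans hwM) k
  rw [hper] at h3
  have h4 : (2 : ℝ) ≤ 2 ^ k := le_self_pow₀ one_le_two hk.ne'
  nlinarith

theorem P_crit_zero (x : Poly3) : P x (crit x 0) = x 1 ^ 3 - x 0 ^ 3 / 6 := by
  simp only [P, crit, Matrix.cons_val_zero]
  ring

theorem P_crit_one (x : Poly3) : P x (crit x 1) = x 1 ^ 3 := by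
  simp [P, crit]

theorem norm_crit_le {x : Poly3} {M : ℝ} (h0 : ‖x 0‖ ≤ M) (i : Fin 2) : ‖crit x i‖ ≤ M := by
  fin_cases i
  · simpa [crit] using h0
  · simpa [crit] using (norm_nonneg _).trans h0

/-- If one critical value is small compared to the parameter, then the other one is large. -/
theorem norm_P_crit_ge {x : Poly3} {M : ℝ} (hM : 10 ≤ M) (hx : M = max ‖x 0‖ ‖x 1‖)
    {i j : Fin 2} (hij : i ≠ j) (hi : ‖P x (crit x i)‖ < 3 * M) :
    M ^ 3 / 8 ≤ ‖P x (crit x j)‖ := by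
  -- Since `M ^ 2 ≥ 100`, the error `3 * M` is below `M ^ 3 / 6 - M ^ 3 / 8`.
  have hsq : 0 ≤ M * (M ^ 2 - 100) := mul_nonneg (by linarith) (by nlinarith)
  have hc : ‖x 0‖ ^ 3 / 6 ≤ ‖x 1 ^ 3 - x 0 ^ 3 / 6‖ + ‖x 1 ^ 3‖ := by
    have h := norm_sub_le (x 1 ^ 3) (x 1 ^ 3 - x 0 ^ 3 / 6)
    rw [sub_sub_cancel, norm_div, norm_pow] at h
    simp only [Complex.norm_ofNat] at h
    linarith
  have h3 : ‖x 1 ^ 3‖ = ‖x 1‖ ^ 3 := norm_pow _ _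
  have hpos : 0 ≤ M ^ 3 := by positivity
  rcases max_choice ‖x 0‖ ‖x 1‖ with h | h <;> rw [h] at hx <;>
    fin_cases i <;> fin_cases j <;>
    simp only [Fin.zero_eta, Fin.mk_one, Fin.isValue, ne_eq, not_true_eq_false, P_crit_zero,
      P_crit_one] at hij hi ⊢ <;> rw [← hx] at * <;> nlinarith

/-- If the orbit of the critical point `c_i` is bounded, the other critical point `c_j` escapes so
fast that the quotient of `P^m(c_j) - c_j` by `P(c_j) - c_j` is large. -/
theorem norm_iterate_crit_sub_ge {x : Poly3} {M : ℝ} (hM : 10 ≤ M) (hx : M = max ‖x 0‖ ‖x 1‖)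
    {i j : Fin 2} (hij : i ≠ j) (hi : ‖P x (crit x i)‖ < 3 * M) (m : ℕ) :
    P x (crit x j) ≠ crit x j ∧
      M * ‖P x (crit x j) - crit x j‖ ≤ ‖(P x)^[m + 2] (crit x j) - crit x j‖ := by
  have h0 : ‖x 0‖ ≤ M := hx ▸ le_max_left _ _
  have h1 : ‖x 1‖ ≤ M := hx ▸ le_max_right _ _
  have hj := norm_crit_le h0 j
  have hG := norm_P_crit_ge hM hx hij hi
  set G := ‖P x (crit x j)‖ with hGdef
  have hGM : 12 * M ≤ G := by
    nlinarith [mul_nonneg (by linarith : 0 ≤ M) (by nlinarith : 0 ≤ M ^ 2 - 100)]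
  constructor
  · intro h
    rw [h] at hGdef
    linarith
  -- One iterate reaches norm `G`, the next `m` do not decrease it, and the last cubes it; the cube
  -- beats `M * (G + M) ≤ 2 * G ^ 2`.
  have h2 : G ^ 3 / 8 ≤ ‖(P x)^[m + 2] (crit x j)‖ := by
    have h3 := norm_iterate_ge h0 h1 (by linarith) (by linarith : 3 * M ≤ G) m
    rw [← Function.iterate_succ_apply] at h3
    have h4 : G ≤ 2 ^ m * G := le_mul_of_one_le_left (norm_nonneg _) (one_le_pow₀ one_le_two)
    have h5 := norm_P_ge h0 h1 (by linarith : 3 * M ≤ ‖(P x)^[m + 1] (crit x j)‖)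
    rw [← Function.iterate_succ_apply' (P x)] at h5
    refine le_trans ?_ h5
    gcongr
    exact h4.trans h3
  have h6 : ‖(P x)^[m + 2] (crit x j)‖ ≤ ‖(P x)^[m + 2] (crit x j) - crit x j‖ + ‖crit x j‖ := by
    simpa using norm_add_le ((P x)^[m + 2] (crit x j) - crit x j) (crit x j)
  have h7 : ‖P x (crit x j) - crit x j‖ ≤ G + M := (norm_sub_le _ _).trans (by gcongr)
  have h8 : M * ‖P x (crit x j) - crit x j‖ ≤ M * (G + M) := by gcongr
  have h9 : M * (G + M) ≤ G * (2 * G) := by gcongr <;> linarith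
  nlinarith [mul_nonneg (by linarith : 0 ≤ G) (by nlinarith : 0 ≤ G ^ 2 - 100 * G)]

theorem finite_range_iterate {α : Type*} {f : α → α} {z : α} {n k : ℕ} (hk : 0 < k)
    (h : f^[n + k] z = f^[n] z) : (Set.range fun m : ℕ => f^[m] z).Finite := by
  refine ((Set.finite_lt_nat (n + k)).image fun m => f^[m] z).subset ?_
  rintro _ ⟨m, rfl⟩
  induction m using Nat.strong_induction_on with
  | _ m ih =>
    by_cases hm : m < n + k
    · exact ⟨m, hm, rfl⟩
    · obtain ⟨d, rfl⟩ := Nat.exists_eq_add_of_le (not_lt.1 hm)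
      have := ih (n + d) (by omega)
      convert this using 1
      change f^[n + k + d] z = f^[n + d] z
      rw [add_comm, Function.iterate_add_apply, h, add_comm n, Function.iterate_add_apply]

theorem eq_crit_of_deriv_eq_zero {x : Poly3} {z : ℂ} (hz : deriv (P x) z = 0) :
    ∃ i, z = crit x i := by
  have hd : HasDerivAt (P x) ((1 / 3) * (3 * z ^ 2) - (x 0 / 2) * (2 * z)) z := by
    have h3 := (hasDerivAt_pow 3 z).const_mul (1 / 3 : ℂ)
    have h2 := (hasDerivAt_pow 2 z).const_mul (x 0 / 2)
    change HasDerivAt (fun z => (1 / 3) * z ^ 3 - (x 0 / 2) * z ^ 2 + x 1 ^ 3) _ z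
    simpa using (h3.sub h2).add_const (x 1 ^ 3)
  rw [hd.deriv] at hz
  have : z * (z - x 0) = 0 := by linear_combination hz
  rcases mul_eq_zero.1 this with h | h
  · exact ⟨1, by simpa [crit] using h⟩
  · exact ⟨0, by simpa [crit] using sub_eq_zero.1 h⟩

theorem isPCF_of_forall_crit {x : Poly3}
    (h : ∀ i, ∃ n k : ℕ, 0 < k ∧ x ∈ preperLocus n k i) : x.IsPCF := by
  intro z hz
  obtain ⟨i, rfl⟩ := eq_crit_of_deriv_eq_zero hz
  obtain ⟨n, k, hk, hx⟩ := h i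
  exact finite_range_iterate hk hx

end Poly3
-- Critical orbits as polynomials in `a` over `ℂ[c]`
namespace Poly3
open Polynomial

/-- The iterate `P^m(c_i)` as a polynomial in `a` over `ℂ[c]`. -/
noncomputable def critOrbit (i : Fin 2) : ℕ → ℂ[X][X]
  | 0 => ![C X, 0] i
  | m + 1 => C (C (1 / 3)) * critOrbit i m ^ 3 - C (C (1 / 2) * X) * critOrbit i m ^ 2 + X ^ 3

/-- The quotient of `P^m(c_j) - c_j` by `P(c_j) - c_j`, as a polynomial in `a` over `ℂ[c]`. -/
noncomputable def critQuot (j : Fin 2) : ℕ → ℂ[X][X]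
  | 0 => 0
  | m + 1 => 1 + (critOrbit j 1 - critOrbit j 0) * critQuot j m ^ 2 *
      (C (C (1 / 3)) * critOrbit j m + (![C (C (1 / 6) * X), -C (C (1 / 2) * X)] j : ℂ[X][X]))

theorem evalEval_critOrbit (i : Fin 2) (m : ℕ) (x : Poly3) :
    (critOrbit i m).evalEval (x 0) (x 1) = (P x)^[m] (crit x i) := by
  induction m with
  | zero => fin_cases i <;> simp [critOrbit, crit, evalEval_C]
  | succ m ih =>
    rw [Function.iterate_succ_apply', ← ih, critOrbit, P]
    simp only [evalEval_add, evalEval_sub, evalEval_mul, evalEval_pow, evalEval_C, evalEval_X,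
      eval_mul, eval_C, eval_X]
    ring

/-- As `c_j` is critical, `P(g) - P(c_j)` is divisible by `(g - c_j) ^ 2`; the cofactor is `g/3 +
c/6` for `c_0` and `g/3 - c/2` for `c_1`. -/
theorem evalEval_critQuot_mul (j : Fin 2) (m : ℕ) (x : Poly3) :
    (critQuot j m).evalEval (x 0) (x 1) * (P x (crit x j) - crit x j) =
      (P x)^[m] (crit x j) - crit x j := by
  induction m with
  | zero => simp [critQuot]
  | succ m ih =>
    rw [Function.iterate_succ_apply', critQuot]
    have h0 := evalEval_critOrbit j 0 x
    have h1 := evalEval_critOrbit j 1 x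
    simp only [evalEval_add, evalEval_sub, evalEval_mul, evalEval_pow, evalEval_C,
      eval_C, evalEval_one, evalEval_critOrbit, h0, h1]
    simp only [Function.iterate_one, Function.iterate_zero, id]
    set g := (P x)^[m] (crit x j)
    set t := (critQuot j m).evalEval (x 0) (x 1)
    set D := P x (crit x j) - crit x j with hD
    set R := (![C (C (1 / 6) * X), -C (C (1 / 2) * X)] j : ℂ[X][X]).evalEval (x 0) (x 1) with hR
    have hP : P x g - P x (crit x j) = (g - crit x j) ^ 2 * (1 / 3 * g + R) := by
      fin_cases j
      · simp [P, crit, hR, evalEval_C]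
        ring
      · simp [P, crit, hR, evalEval_C]
        ring
    have hg : g = t * D + crit x j := by linear_combination -ih
    have : P x g - crit x j = P x g - P x (crit x j) + D := by rw [hD]; ring
    rw [this, hP, ← ih]
    ring

theorem evalEval_critQuot_of_eq {j : Fin 2} {x : Poly3} (hx : P x (crit x j) = crit x j) (m : ℕ) :
    (critQuot j (m + 1)).evalEval (x 0) (x 1) = 1 := by
  have h0 := evalEval_critOrbit j 0 x
  have h1 := evalEval_critOrbit j 1 x
  rw [Function.iterate_one, hx] at h1
  rw [critQuot]
  simp only [evalEval_add, evalEval_mul, evalEval_sub, h0, h1]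
  simp

/-- Starting from `a ^ 3 + b(c)`, each iterate triples the degree in `a` and sends the leading
constant `r` to `r ^ 3 / 3`. -/
theorem critOrbit_coeff (i : Fin 2) (m : ℕ) :
    (critOrbit i (m + 1)).natDegree ≤ 3 ^ (m + 1) ∧
      ∃ r : ℂ, r ≠ 0 ∧ (critOrbit i (m + 1)).coeff (3 ^ (m + 1)) = C r := by
  induction m with
  | zero =>
    have h : ∃ b : ℂ[X], critOrbit i 1 = X ^ 3 + C b := by
      fin_cases i
      · exact ⟨C (1 / 3) * X ^ 3 - C (1 / 2) * X * X ^ 2, by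
          simp [critOrbit]
          ring⟩
      · exact ⟨0, by simp [critOrbit]⟩
    obtain ⟨b, hb⟩ := h
    rw [zero_add, hb]
    exact ⟨(natDegree_X_pow_add_C).le, 1, one_ne_zero, by simp [coeff_X_pow]⟩
  | succ m ih =>
    obtain ⟨hd, r, hr, hc⟩ := ih
    set d := 3 ^ (m + 1) with hdd
    have hd3 : 3 ≤ d := by
      rw [hdd]
      exact le_self_pow₀ (by norm_num) (by omega)
    have he : 3 ^ (m + 1 + 1) = 3 * d := by rw [hdd, pow_succ 3 (m + 1), mul_comm]
    have h3 := natDegree_pow_le_of_le 3 hd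
    have h2 := natDegree_pow_le_of_le 2 hd
    rw [he, critOrbit]
    refine ⟨?_, 1 / 3 * r ^ 3, by simpa using hr, ?_⟩
    · refine natDegree_add_le_of_degree_le ((natDegree_sub_le _ _).trans (max_le
        ((natDegree_C_mul_le _ _).trans h3) ((natDegree_C_mul_le _ _).trans (h2.trans ?_)))) ?_
      · omega
      · rw [natDegree_X_pow]
        omega
    · rw [coeff_add, coeff_sub, coeff_C_mul, coeff_C_mul, coeff_pow_of_natDegree_le hd, hc,
        coeff_eq_zero_of_natDegree_lt (h2.trans_lt (by omega)), coeff_X_pow, if_neg (by omega)]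
      simp

theorem natDegree_critOrbit_le (i : Fin 2) (m : ℕ) {N : ℕ} (hm : m < N) :
    (critOrbit i m).natDegree < 3 ^ N := by
  cases m with
  | zero =>
    have : (critOrbit i 0).natDegree = 0 := by fin_cases i <;> simp [critOrbit]
    rw [this]
    positivity
  | succ m => exact (critOrbit_coeff i m).1.trans_lt (Nat.pow_lt_pow_right (by norm_num) hm)

theorem isUnit_leadingCoeff_critOrbit_sub (n : ℕ) {k : ℕ} (hk : 0 < k) (i : Fin 2) :
    IsUnit (critOrbit i (n + k) - critOrbit i n).leadingCoeff := by
  have hlt := natDegree_critOrbit_le i n (N := n + k) (by omega)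
  obtain ⟨m, hm⟩ : ∃ m, n + k = m + 1 := ⟨n + k - 1, by omega⟩
  rw [hm] at hlt ⊢
  obtain ⟨hd, r, hr, hc⟩ := critOrbit_coeff i m
  have hc' : (critOrbit i (m + 1) - critOrbit i n).coeff (3 ^ (m + 1)) = C r := by
    rw [coeff_sub, hc, coeff_eq_zero_of_natDegree_lt hlt, sub_zero]
  have hdeg : (critOrbit i (m + 1) - critOrbit i n).natDegree = 3 ^ (m + 1) :=
    le_antisymm ((natDegree_sub_le _ _).trans (max_le hd hlt.le))
      (le_natDegree_of_ne_zero (by rw [hc']; simpa using hr))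
  rw [leadingCoeff, hdeg, hc']
  exact isUnit_C.2 hr.isUnit

theorem eval_equivMvPolynomial (x : Poly3) (p : ℂ[X][X]) :
    MvPolynomial.eval x (Bivariate.equivMvPolynomial ℂ p) = p.evalEval (x 0) (x 1) := by
  have : ((MvPolynomial.eval x).comp (Bivariate.equivMvPolynomial ℂ : ℂ[X][X] →+* _)) =
      evalEvalRingHom (x 0) (x 1) := by
    ext <;> simp
  exact congrArg (fun φ : ℂ[X][X] →+* ℂ => φ p) this

/-- The components of the locus where `c_i` is preperiodic are zero sets of polynomials monic
in `a`. -/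
theorem IsIrredComponent.exists_monic {n k : ℕ} (hk : 0 < k) {i : Fin 2} {C : Set Poly3}
    (hC : IsIrredComponent C (preperLocus n k i)) :
    ∃ f : ℂ[X][X], f.Monic ∧ f.natDegree ≠ 0 ∧ C = {x | f.evalEval (x 0) (x 1) = 0} := by
  set F := critOrbit i (n + k) - critOrbit i n with hFdef
  have hlc := isUnit_leadingCoeff_critOrbit_sub n hk i
  rw [← hFdef] at hlc
  have hF : F ≠ 0 := by
    rintro h
    simp [h] at hlc
  have hlocus : preperLocus n k i =
      {x | MvPolynomial.eval x (Bivariate.equivMvPolynomial ℂ F) = 0} := by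
    ext x
    rw [Set.mem_ofPred_eq, eval_equivMvPolynomial, hFdef, evalEval_sub, evalEval_critOrbit,
      evalEval_critOrbit, sub_eq_zero]
    rfl
  rw [hlocus] at hC
  obtain ⟨f, hf, hdvd, rfl⟩ := hC.exists_irreducible (by simpa using hF)
  obtain ⟨f, rfl⟩ := (Bivariate.equivMvPolynomial ℂ).surjective f
  rw [MulEquiv.irreducible_iff] at hf
  have hfF : f ∣ F := (map_dvd_iff (Bivariate.equivMvPolynomial ℂ)).1 hdvd
  -- Factors inherit a constant leading coefficient, so rescaling makes `f` monic.
  have hu : IsUnit f.leadingCoeff := isUnit_of_dvd_unit (leadingCoeff_dvd_leadingCoeff hfF) hlc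
  have hmonic := monic_of_isUnit_leadingCoeff_inv_smul hu
  refine ⟨_, hmonic, fun h => ?_, ?_⟩
  · have h1 := hmonic.natDegree_eq_zero.1 h
    have : f = hu.unit • (1 : ℂ[X][X]) := by rw [← h1, smul_inv_smul]
    apply hf.not_isUnit
    rw [this, Units.smul_def, smul_eq_C_mul, mul_one]
    exact hu.unit.isUnit.map C
  · ext x
    rw [Set.mem_ofPred_eq, Set.mem_ofPred_eq, eval_equivMvPolynomial, Units.smul_def, smul_eq_C_mul,
      evalEval_mul, evalEval_C, mul_eq_zero]
    have : eval (x 0) (↑hu.unit⁻¹ : ℂ[X]) ≠ 0 := (hu.unit⁻¹.isUnit.map (evalRingHom (x 0))).ne_zero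
    simp [this]

/-- On each component of the locus where `c_i` is preperiodic, and for every `m`, there is a parameter
at which the other critical point `c_j` is fixed by the `m + 2`-nd iterate but not by `P`. -/
theorem IsIrredComponent.exists_isPeriodicPt {n k : ℕ} (hk : 0 < k) {i j : Fin 2} (hij : i ≠ j)
    {C : Set Poly3} (hC : IsIrredComponent C (preperLocus n k i)) (m : ℕ) :
    ∃ x ∈ C, Function.IsPeriodicPt (P x) (m + 2) (crit x j) ∧ P x (crit x j) ≠ crit x j := by
  have hsub : C ⊆ preperLocus n k i := hC.1.1
  obtain ⟨f, hf, hdeg, rfl⟩ := hC.exists_monic hk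
  obtain ⟨c, a, hfca, hca⟩ := hf.exists_evalEval_eq_zero_of_norm_le (h := critQuot j (m + 2)) hdeg
    10 fun c a hca hc => by
      have hx : ![c, a] ∈ preperLocus n k i := hsub (by simpa using hca)
      set x : Poly3 := ![c, a]
      have hM : 10 ≤ max ‖x 0‖ ‖x 1‖ := hc.trans (le_max_left _ _)
      obtain ⟨hne, hge⟩ := norm_iterate_crit_sub_ge hM rfl hij
        (norm_iterate_lt_of_mem_preperLocus hk hx (le_max_left _ _) (le_max_right _ _)
          (by linarith) 1) m
      rw [← evalEval_critQuot_mul, norm_mul] at hge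
      exact (le_max_left _ _).trans
        (le_of_mul_le_mul_right hge (norm_pos_iff.2 (sub_ne_zero.2 hne)))
  set x : Poly3 := ![c, a]
  have hq : (critQuot j (m + 2)).evalEval (x 0) (x 1) = 0 := hca
  refine ⟨x, hfca, ?_, fun h => ?_⟩
  · have h := evalEval_critQuot_mul j (m + 2) x
    rw [hq, zero_mul] at h
    exact sub_eq_zero.1 h.symm
  · rw [evalEval_critQuot_of_eq h] at hq
    exact one_ne_zero hq

end Poly3

/-! ### One parameter for each prime period -/

theorem lemma5p2 (n k : ℕ) (hk : 0 < k) (i : Fin 2) (C : Set Poly3)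
    (hC : Poly3.IsIrredComponent C (Poly3.preperLocus n k i)) :
    {x : Poly3 | x ∈ C ∧ x.IsPCF}.Infinite := by
  obtain ⟨j, hij⟩ := exists_ne i
  have hex : ∀ p : ℕ, ∃ x : Poly3, p.Prime → x ∈ C ∧
      Function.IsPeriodicPt (Poly3.P x) p (x.crit j) ∧ Poly3.P x (x.crit j) ≠ x.crit j := by
    intro p
    by_cases hp : p.Prime
    · obtain ⟨m, rfl⟩ := Nat.exists_eq_add_of_le' hp.two_le
      obtain ⟨x, hx⟩ := hC.exists_isPeriodicPt hk hij.symm m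
      exact ⟨x, fun _ => hx⟩
    · exact ⟨0, fun h => absurd h hp⟩
  choose x hx using hex
  refine Set.infinite_of_injOn_mapsTo (s := {p | p.Prime}) (f := x) ?_ ?_
    Nat.infinite_setOfPred_prime
  · intro p hp q hq hpq
    by_contra hne
    obtain ⟨-, hpp, hfix⟩ := hx p hp
    have hqq := (hx q hq).2.1
    rw [← hpq] at hqq
    -- A common parameter for two distinct primes would make `c_j` fixed, the gcd being `1`.
    have h1 := hpp.gcd hqq
    rw [(Nat.coprime_primes hp hq).2 hne] at h1
    exact hfix h1
  · intro p hp
    obtain ⟨hC', hper, -⟩ := hx p hp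
    refine ⟨hC', Poly3.isPCF_of_forall_crit fun l => ?_⟩
    by_cases hl : l = j
    · exact ⟨0, p, Nat.Prime.pos hp, by
        rw [hl, Poly3.preperLocus, Set.mem_ofPred_eq, zero_add]
        exact hper⟩
    · have : l = i := by omega
      exact ⟨n, k, hk, this ▸ hC.1.1 hC'⟩
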